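/- **Setting.** Consider a cooperative constrained Markov game with agents $\mathcal N=\{1,\dots,N\}$, $N\ge 1$, constraints $\mathcal K=\{1,\dots,K\}$, a finite nonempty state space $\mathcal S$, finite nonempty action sets $\mathcal A_n$, $\mathcal A=\prod_n\mathcal A_n$, transition kernel $P(s'|s,a)$, expected local costs $c_n(s,a)\in[0,1]$ and constraint costs $g_{n,k}(s,a)\in[0,1]$, and constraint levels $b_k\le 1$. Let $\mathcal P_n=\Delta(\mathcal A_n)^{\mathcal S}$ and let $\mathcal P$ be the set of product policies $\pi(a|s)=\prod_n\pi_n(a_n|s)$, $\pi_n\in\mathcal P_n$. Assume that every $\pi\in\mathcal P$ has a unique stationary state distribution $d^\pi(s)$, and put $d^\pi(s,a)=d^\pi(s)\pi(a|s)$, $$J(\pi)=\sum_{s,a}d^\pi(s,a)\tfrac1N\sum_n c_n(s,a),\qquad G_k(\pi)=\sum_{s,a}d^\pi(s,a)\tfrac1N\sum_n g_{n,k}(s,a),$$ $$\mathcal L(\pi,\lambda)=J(\pi)+\sum_k\lambda_k\,(G_k(\pi)-b_k).$$ Let $\mathbf P^*=\min_{\pi\in\mathcal P}\max_{\lambda\in\mathbb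 R_+^K}\mathcal L(\pi,\lambda)$, $\mathbf D^*=\max_{\lambda\in\mathbb R_+^K}\min_{\pi\in\mathcal P}\mathcal L(\pi,\lambda)$ and $\bar\Delta=\mathbf P^*-\mathbf D^*$. Assume Slater's condition: there are $\tilde\pi\in\mathcal P$ and $\delta_k>0$ with $G_k(\tilde\pi)\le b_k-\delta_k$ for all $k$. Put $\lambda_k^{\max}=(1+\bar\Delta)/\delta_k$, $\lambda^{\max}=(\lambda^{\max}_1,\dots,\lambda^{\max}_K)$ and $\Lambda=\prod_k[0,\lambda^{\max}_k]$. **Parameterization.** Let $\Theta_n\subseteq\mathbb R^m$ be compact and convex, $\Theta=\prod_n\Theta_n$, and let $\pi_{\theta_n}\in\mathcal P_n$, $\theta_n\in\Theta_n$, be positive and twice continuously differentiable in $\theta_n$; write $\pi_\theta=\prod_n\pi_{\theta_n}$. Assume that the state chain under every $\pi_\theta$, $\theta\in\Theta$, is irreducible and aperiodic, and that for each $n$ the parameterization is an $\epsilon_n$-individual parameterization: for every $\pi_n\in\mathcal P_n$ there is $\theta_n\in\Theta_n$ with $\max_s\sum_{a_n}|\pi_n(a_n|s)-\pi_{\theta_n}(a_n|s)|\le\epsilon_n$.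 Let $\theta^*$ be a solution of $\max_{\lambda\in\Lambda}\min_{\theta\in\Theta}\mathcal L(\pi_\theta,\lambda)$, i.e. for some $\lambda_\theta\in\Lambda$ which maximizes $\min_{\theta\in\Theta}\mathcal L(\pi_\theta,\cdot)$ over $\Lambda$, $\theta^*$ minimizes $\mathcal L(\pi_\theta,\lambda_\theta)$ over $\Theta$. **Algorithm.** With step sizes $\alpha^t,\beta^t,\gamma^t$, communication weights $\mathrm C^t=[c^t_{n,n'}]$, features $\phi(s,a)$ and linear critic $Q(s,a;w)=\phi(s,a)^\top w$, start from $\theta^0\in\Theta$, $\hat\lambda^0_n\in\Lambda$ and an action $a^0\sim\pi_{\theta^0}(\cdot|s^0)$. At each time $t$ the next state is $s^{t+1}\sim P(\cdot|s^t,a^t)$; immediate costs $c_n^{t+1},g_{n,k}^{t+1}\in[0,1]$ with conditional means $c_n(s^t,a^t),g_{n,k}(s^t,a^t)$ are observed; $a^{t+1}\sim\pi_{\theta^t}(\cdot|s^{t+1})$ is played; and, with $l_n^{t+1}=c_n^{t+1}+\sum_k\hat\lambda^t_{n,k}(g^{t+1}_{n,k}-b_k)$, each agent $n$ updates $$\hat{\mathcal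 L}_n^{t+1}=\hat{\mathcal L}_n^t+\alpha^t(l_n^{t+1}-\hat{\mathcal L}_n^t),\quad \delta_n^t=l_n^{t+1}-\hat{\mathcal L}_n^t+Q(s^{t+1},a^{t+1};w_n^t)-Q(s^t,a^t;w_n^t),$$ $$w_n^{t+1}=\sum_{n'}c^t_{n,n'}\big(w_{n'}^t+\alpha^t\delta_{n'}^t\phi(s^t,a^t)\big),\quad \hat G_n^{t+1}=\hat G_n^t+\alpha^t(g_n^{t+1}-\hat G_n^t),$$ $$A_n^t=Q(s^t,a^t;w_n^t)-\sum_{a_n\in\mathcal A_n}\pi_{\theta_n^t}(a_n|s^t)Q(s^t,(a_n,a_{-n}^t);w_n^t),$$ $$\theta_n^{t+1}=P_{\Theta_n}\big[\theta_n^t-\beta^tA_n^t\nabla_{\theta_n}\log\pi_{\theta_n^t}(a_n^t|s^t)\big],\quad \hat\lambda_n^{t+1}=P_\Lambda\Big[\sum_{n'}c^t_{n,n'}\hat\lambda_{n'}^t+\gamma^t(\hat G_n^t-b)\Big],$$ where $P_{\Theta_n}$ and $P_\Lambda$ denote Euclidean projections. **Proposition.** $\mathbf P^*$ and $\mathbf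 D^*$ are finite, and almost surely the following holds: if the iterates converge, $\theta_n^t\to\bar\theta_n$ and $\hat\lambda_n^t\to\bar\lambda$ for all $n\in\mathcal N$, then $$\mathbf P^*-\mathcal L(\pi_{\bar\theta},\bar\lambda)\;\le\;\|\lambda^{\max}\|_1+\big(1+K\|\lambda^{\max}\|_1\big)\Big(\kappa^*\sum_{n\in\mathcal N}\epsilon_n+\bar\epsilon\Big)+\bar\Delta ,$$ where $\bar\epsilon=\sum_{s,a}|d^{\pi_{\theta^*}}(s,a)-d^{\pi_{\bar\theta}}(s,a)|$, $\kappa^*=\max_{\pi\in\mathcal P}\kappa^\pi$, and $\kappa^\pi=\sum_{s'}d^\pi(s')\,\mathbb E^\pi_s[\min\{t\ge1: s^t=s'\}]$ is Kemeny's constant of the state chain under $\pi$ (which does not depend on the initial state $s$). -/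

import Mathlib

open MeasureTheory ProbabilityTheory Filter Topology

open scoped ENNReal

noncomputable section

namespace CMARL

/-- A cooperative constrained Markov game with `N` agents, `K` constraints, finite state space `S`
and finite action spaces `A n`. The expected local costs `c n` and expected local constraint costs
`g n k` take values in `[0, 1]`; `b k` is the upper bound of the `k`-th constraint. -/
structure Game (N K : ℕ) (S : Type*) (A : Fin N → Type*) [Fintype S] where
  P : S → (∀ n, A n) → S → ℝ
  P_mem : ∀ s a, P s a ∈ stdSimplex ℝ S
  c : Fin N → S → (∀ n, A n) → ℝ
  c_mem : ∀ n s a, c n s a ∈ Set.Icc (0 : ℝ) 1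
  g : Fin N → Fin K → S → (∀ n, A n) → ℝ
  g_mem : ∀ n k s a, g n k s a ∈ Set.Icc (0 : ℝ) 1
  b : Fin K → ℝ

section

variable {N K : ℕ} {S : Type*} {A : Fin N → Type*}

/-- The joint conditional distribution `π(a|s) = ∏ n, π_n(a_n|s)` of local policies `π_n`. -/
def jointPolicy (p : ∀ n, S → A n → ℝ) : S → (∀ n, A n) → ℝ :=
  fun s a => ∏ n, p n s (a n)

/-- The local policy space `𝒫_n = Δ(A_n)^S` of an agent with action space `B`. -/
def localPolicies (S B : Type*) [Fintype B] : Set (S → B → ℝ) :=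
  {p | ∀ s, p s ∈ stdSimplex ℝ B}

/-- The space `𝒫` of product policies. -/
def productPolicies (S : Type*) (A : Fin N → Type*) [∀ n, Fintype (A n)] :
    Set (S → (∀ n, A n) → ℝ) :=
  {π | ∃ p : ∀ n, S → A n → ℝ, (∀ n, p n ∈ localPolicies S (A n)) ∧ π = jointPolicy p}

/-- The nonnegative orthant `ℝ₊^K`. -/
def orthant (K : ℕ) : Set (EuclideanSpace ℝ (Fin K)) := {l | ∀ k, 0 ≤ l k}

/-- The `L¹` norm of a vector. -/
def l1norm (l : EuclideanSpace ℝ (Fin K)) : ℝ := ∑ k, |l k|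

/-- `x` is the Euclidean projection of `z` onto the set `C`. -/
def IsProjection {E : Type*} [NormedAddCommGroup E] (C : Set E) (z x : E) : Prop :=
  x ∈ C ∧ ∀ y ∈ C, ‖z - x‖ ≤ ‖z - y‖

/-- `survival Q y t x` is the probability that the Markov chain with transition matrix `Q`, started
at `x`, does not visit `y` at any of the times `1, …, t`. -/
def survival [Fintype S] [DecidableEq S] (Q : Matrix S S ℝ) (y : S) : ℕ → S → ℝ
  | 0, _ => 1
  | t + 1, x => ∑ u, if u = y then 0 else Q x u * survival Q y t u

/-- The mean first passage time `𝔼_x[T_y]`, `T_y = min {t ≥ 1 | s^t = y}`, written as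
`∑_{t ≥ 0} ℙ_x(T_y > t)`. For `x = y` it is the mean return time. -/
def meanPassageTime [Fintype S] [DecidableEq S] (Q : Matrix S S ℝ) (x y : S) : ℝ≥0∞ :=
  ∑' t, ENNReal.ofReal (survival Q y t x)

/-- Irreducibility of the Markov chain with transition matrix `Q`. -/
def IsIrreducibleChain [Fintype S] [DecidableEq S] (Q : Matrix S S ℝ) : Prop :=
  ∀ x y, ∃ t : ℕ, 0 < (Q ^ t) x y

/-- Aperiodicity: for every state, the greatest common divisor of the possible return times
is `1`. -/
def IsAperiodicChain [Fintype S] [DecidableEq S] (Q : Matrix S S ℝ) : Prop :=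
  ∀ x, ∀ d : ℕ, (∀ t : ℕ, 0 < t → 0 < (Q ^ t) x x → d ∣ t) → d = 1

end

namespace Game

variable {N K : ℕ} {S : Type*} {A : Fin N → Type*} [Fintype S] [∀ n, Fintype (A n)]

/-- Transition matrix of the state chain under the policy `π`. -/
def transition (M : Game N K S A) (π : S → (∀ n, A n) → ℝ) : Matrix S S ℝ :=
  fun s s' => ∑ a, π s a * M.P s a s'

/-- `d` is a stationary distribution of the state chain under `π`. -/
def IsStationary (M : Game N K S A) (π : S → (∀ n, A n) → ℝ) (d : S → ℝ) : Prop :=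
  d ∈ stdSimplex ℝ S ∧ ∀ s', ∑ s, d s * M.transition π s s' = d s'

open Classical in
/-- The stationary distribution `d^π(s)`. It is only used where it exists and is unique. -/
def stationary (M : Game N K S A) (π : S → (∀ n, A n) → ℝ) : S → ℝ :=
  if h : ∃ d, M.IsStationary π d then h.choose else 0

/-- The occupation measure `d^π(s, a) = d^π(s) π(a|s)`. -/
def occupation (M : Game N K S A) (π : S → (∀ n, A n) → ℝ) (s : S) (a : ∀ n, A n) : ℝ :=
  M.stationary π s * π s a

/-- The `L¹` distance of the occupation measures of two policies. -/
def occupationDist (M : Game N K S A) (π π' : S → (∀ n, A n) → ℝ) : ℝ :=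
  ∑ s, ∑ a, |M.occupation π s a - M.occupation π' s a|

/-- The global objective cost `J(π)`, the stationary average of `c = (1/N) ∑ n, c n`. -/
def objective (M : Game N K S A) (π : S → (∀ n, A n) → ℝ) : ℝ :=
  ∑ s, M.stationary π s * ∑ a, π s a * ((1 / (N : ℝ)) * ∑ n, M.c n s a)

/-- The global constraint function `G_k(π)`, the stationary average of `(1/N) ∑ n, g n k`. -/
def constraint (M : Game N K S A) (k : Fin K) (π : S → (∀ n, A n) → ℝ) : ℝ :=
  ∑ s, M.stationary π s * ∑ a, π s a * ((1 / (N : ℝ)) * ∑ n, M.g n k s a)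

/-- The global Lagrangian `ℒ(π, λ)`. -/
def lagrangian (M : Game N K S A) (π : S → (∀ n, A n) → ℝ) (l : EuclideanSpace ℝ (Fin K)) : ℝ :=
  M.objective π + ∑ k, l k * (M.constraint k π - M.b k)

/-- `P* = min_{π ∈ 𝒫} max_{λ ∈ ℝ₊^K} ℒ(π, λ)`. The inner maximum is `+∞` for infeasible `π`. -/
def primalValue (M : Game N K S A) : EReal :=
  ⨅ π ∈ productPolicies S A, ⨆ l ∈ orthant K, ((M.lagrangian π l : ℝ) : EReal)

/-- `D* = max_{λ ∈ ℝ₊^K} min_{π ∈ 𝒫} ℒ(π, λ)`. -/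
def dualValue (M : Game N K S A) : EReal :=
  ⨆ l ∈ orthant K, ⨅ π ∈ productPolicies S A, ((M.lagrangian π l : ℝ) : EReal)

/-- The unparameterized duality gap `P* - D*`, for finite `P*` and `D*`. -/
def dualityGap (M : Game N K S A) : ℝ := M.primalValue.toReal - M.dualValue.toReal

/-- `λ_k^max = (1 + P* - D*) / δ_k`. -/
def lamMax (M : Game N K S A) (δ : Fin K → ℝ) : EuclideanSpace ℝ (Fin K) :=
  WithLp.toLp 2 fun k => (1 + M.dualityGap) / δ k

/-- The box `Λ = [0, λ_1^max] × ⋯ × [0, λ_K^max]`. -/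
def multiplierBox (M : Game N K S A) (δ : Fin K → ℝ) : Set (EuclideanSpace ℝ (Fin K)) :=
  {l | ∀ k, l k ∈ Set.Icc 0 (M.lamMax δ k)}

/-- Kemeny's constant `κ^π`: the mean first passage time, weighted by the stationary distribution
over the target states. The sum over targets does not depend on the initial state `s`, so averaging
over `s` is only a way of not singling out a state. -/
def kemeny [DecidableEq S] (M : Game N K S A) (π : S → (∀ n, A n) → ℝ) : ℝ≥0∞ :=
  ∑ s, ENNReal.ofReal (M.stationary π s) *
    ∑ s', ENNReal.ofReal (M.stationary π s') * meanPassageTime (M.transition π) s s'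

/-- `κ* = max_{π ∈ 𝒫} κ^π`. -/
def maxKemeny [DecidableEq S] (M : Game N K S A) : ℝ :=
  (⨆ π ∈ productPolicies S A, M.kemeny π).toReal

end Game

/-- A parameterized class of local policies: agent `n` has a compact convex parameter set
`Θ n ⊆ ℝ^m`, and the policies `π_{θ_n}(·|s)` are positive probability vectors which are twice
continuously differentiable in the parameter (near each point of `Θ n`). -/
structure ParamClass {N : ℕ} (m : ℕ) (S : Type*) (A : Fin N → Type*) [∀ n, Fintype (A n)] where
  Θ : Fin N → Set (EuclideanSpace ℝ (Fin m))
  isCompact : ∀ n, IsCompact (Θ n)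
  convex : ∀ n, Convex ℝ (Θ n)
  pol : ∀ n, EuclideanSpace ℝ (Fin m) → S → A n → ℝ
  pol_mem : ∀ n, ∀ θ ∈ Θ n, pol n θ ∈ localPolicies S (A n)
  pol_pos : ∀ n, ∀ θ ∈ Θ n, ∀ s a, 0 < pol n θ s a
  pol_smooth : ∀ n, ∀ θ ∈ Θ n, ∀ s a, ContDiffAt ℝ 2 (fun x => pol n x s a) θ

namespace ParamClass

variable {N K m : ℕ} {S : Type*} {A : Fin N → Type*} [∀ n, Fintype (A n)]

/-- The product parameter space `Θ = ∏ n, Θ_n`. -/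
def space (F : ParamClass m S A) : Set (Fin N → EuclideanSpace ℝ (Fin m)) :=
  {θ | ∀ n, θ n ∈ F.Θ n}

/-- The product parameterized policy `π_θ(a|s) = ∏ n, π_{θ_n}(a_n|s)`. -/
def policy (F : ParamClass m S A) (θ : Fin N → EuclideanSpace ℝ (Fin m)) :
    S → (∀ n, A n) → ℝ :=
  jointPolicy fun n => F.pol n (θ n)

/-- The parameterization of agent `n` is an `ε`-individual parameterization of `𝒫_n`. -/
def IsIndividualParam (F : ParamClass m S A) (n : Fin N) (ε : ℝ) : Prop :=
  ∀ p ∈ localPolicies S (A n), ∃ θ ∈ F.Θ n, ∀ s, ∑ a, |p s a - F.pol n θ s a| ≤ ε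

/-- `(θ, l)` solves `max_{λ ∈ Λ} min_{θ ∈ Θ} ℒ(π_θ, λ)`: `θ` is a minimizer for the multiplier
`l ∈ Λ`, and `l` maximizes the inner minimum over `Λ`. -/
def IsMaxMinSolution [Fintype S] (F : ParamClass m S A) (M : Game N K S A)
    (Lam : Set (EuclideanSpace ℝ (Fin K))) (θ : Fin N → EuclideanSpace ℝ (Fin m))
    (l : EuclideanSpace ℝ (Fin K)) : Prop :=
  θ ∈ F.space ∧ l ∈ Lam ∧
  (∀ θ' ∈ F.space, M.lagrangian (F.policy θ) l ≤ M.lagrangian (F.policy θ') l) ∧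
  ∀ l' ∈ Lam, (⨅ θ' ∈ F.space, ((M.lagrangian (F.policy θ') l' : ℝ) : EReal)) ≤
    ((M.lagrangian (F.policy θ) l : ℝ) : EReal)

end ParamClass

/-- A run, on the probability space `(Ω, μ)`, of the distributed primal-dual actor-critic algorithm
with critic features `φ` and multiplier set `Lam`. Here `α, β, γ` are the step sizes, `C t` the
communication weight matrix, `s t`, `a t` the state and the joint action, `c t n`, `g t n` the
immediate costs, `θ t n` the actor parameters, `w t n` the critic weights (with linear critic
`Q(s, a; w) = ⟪φ s a, w⟫`), `Lhat`, `Ghat` the running estimates of the Lagrangian and the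
constraint costs, and `lam t n` the local multiplier estimates. -/
structure Run {N K m p : ℕ} {S : Type*} {A : Fin N → Type*} [Fintype S] [∀ n, Fintype (A n)]
    {Ω : Type*} [mΩ : MeasurableSpace Ω] (M : Game N K S A) (F : ParamClass m S A)
    (Lam : Set (EuclideanSpace ℝ (Fin K))) (φ : S → (∀ n, A n) → EuclideanSpace ℝ (Fin p))
    (α β γ : ℕ → ℝ) (μ : Measure Ω) where
  ℱ : Filtration ℕ mΩ
  s : ℕ → Ω → S
  a : ℕ → Ω → ∀ n, A n
  c : ℕ → Fin N → Ω → ℝ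
  g : ℕ → Fin N → Fin K → Ω → ℝ
  C : ℕ → Ω → Matrix (Fin N) (Fin N) ℝ
  θ : ℕ → Ω → Fin N → EuclideanSpace ℝ (Fin m)
  w : ℕ → Ω → Fin N → EuclideanSpace ℝ (Fin p)
  Lhat : ℕ → Ω → Fin N → ℝ
  Ghat : ℕ → Ω → Fin N → EuclideanSpace ℝ (Fin K)
  lam : ℕ → Ω → Fin N → EuclideanSpace ℝ (Fin K)
  -- everything known at time `t` is `ℱ t`-measurable; `C t` is drawn between `t` and `t + 1`
  s_meas : ∀ t, Measurable[ℱ t, ⊤] (s t)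
  a_meas : ∀ t, Measurable[ℱ t, ⊤] (a t)
  c_meas : ∀ t n, Measurable[ℱ t] (c t n)
  g_meas : ∀ t n k, Measurable[ℱ t] (g t n k)
  C_meas : ∀ t i j, Measurable[ℱ (t + 1)] fun ω => C t ω i j
  θ_meas : ∀ t n, Measurable[ℱ t] fun ω => θ t ω n
  w_meas : ∀ t n, Measurable[ℱ t] fun ω => w t ω n
  Lhat_meas : ∀ t n, Measurable[ℱ t] fun ω => Lhat t ω n
  Ghat_meas : ∀ t n, Measurable[ℱ t] fun ω => Ghat t ω n
  lam_meas : ∀ t n, Measurable[ℱ t] fun ω => lam t ω n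
  -- sampling: initial action, next state, immediate costs, next action
  action_zero : ∀ x : ∀ n, A n,
    μ[Set.indicator {ω | a 0 ω = x} (fun _ => (1 : ℝ)) |
        MeasurableSpace.comap (s 0) ⊤ ⊔ MeasurableSpace.comap (θ 0) inferInstance]
      =ᵐ[μ] fun ω => F.policy (θ 0 ω) (s 0 ω) x
  state_succ : ∀ t, ∀ x : S,
    μ[Set.indicator {ω | s (t + 1) ω = x} (fun _ => (1 : ℝ)) | ℱ t]
      =ᵐ[μ] fun ω => M.P (s t ω) (a t ω) x
  c_mem : ∀ t n, ∀ᵐ ω ∂μ, c t n ω ∈ Set.Icc (0 : ℝ) 1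
  g_mem : ∀ t n k, ∀ᵐ ω ∂μ, g t n k ω ∈ Set.Icc (0 : ℝ) 1
  c_succ : ∀ t n, μ[c (t + 1) n | ℱ t] =ᵐ[μ] fun ω => M.c n (s t ω) (a t ω)
  g_succ : ∀ t n k, μ[g (t + 1) n k | ℱ t] =ᵐ[μ] fun ω => M.g n k (s t ω) (a t ω)
  action_succ : ∀ t, ∀ x : ∀ n, A n,
    μ[Set.indicator {ω | a (t + 1) ω = x} (fun _ => (1 : ℝ)) |
        ℱ t ⊔ MeasurableSpace.comap (s (t + 1)) ⊤]
      =ᵐ[μ] fun ω => F.policy (θ t ω) (s (t + 1) ω) x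
  -- initialization
  θ_zero : ∀ᵐ ω ∂μ, θ 0 ω ∈ F.space
  lam_zero : ∀ᵐ ω ∂μ, ∀ n, lam 0 ω n ∈ Lam
  -- critic
  Lhat_succ : ∀ᵐ ω ∂μ, ∀ t n, Lhat (t + 1) ω n = Lhat t ω n +
    α t * ((c (t + 1) n ω + ∑ k, lam t ω n k * (g (t + 1) n k ω - M.b k)) - Lhat t ω n)
  w_succ : ∀ᵐ ω ∂μ, ∀ t n, w (t + 1) ω n = ∑ j, C t ω n j •
    (w t ω j + (α t *
      ((c (t + 1) j ω + ∑ k, lam t ω j k * (g (t + 1) j k ω - M.b k)) - Lhat t ω j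
        + inner ℝ (φ (s (t + 1) ω) (a (t + 1) ω)) (w t ω j)
        - inner ℝ (φ (s t ω) (a t ω)) (w t ω j))) • φ (s t ω) (a t ω))
  -- actor: projected step along the estimated advantage times the score
  θ_succ : ∀ᵐ ω ∂μ, ∀ t n, IsProjection (F.Θ n)
    (θ t ω n - (β t *
      (inner ℝ (φ (s t ω) (a t ω)) (w t ω n)
        - ∑ x : A n, F.pol n (θ t ω n) (s t ω) x *
            inner ℝ (φ (s t ω) (Function.update (a t ω) n x)) (w t ω n))) •
      gradient (fun y => Real.log (F.pol n y (s t ω) (a t ω n))) (θ t ω n))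
    (θ (t + 1) ω n)
  -- constraint cost estimates and multipliers: averaging over neighbours, then projected ascent
  Ghat_succ : ∀ᵐ ω ∂μ, ∀ t n k, Ghat (t + 1) ω n k =
    Ghat t ω n k + α t * (g (t + 1) n k ω - Ghat t ω n k)
  lam_succ : ∀ᵐ ω ∂μ, ∀ t n, IsProjection Lam
    ((∑ j, C t ω n j • lam t ω j) + γ t • (Ghat t ω n - WithLp.toLp 2 M.b))
    (lam (t + 1) ω n)

end CMARL

end

namespace CMARL

/-! Write `P* = D* + gap` and compare `D*` with the Lagrangian at the limit in two moves. Slater's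
condition makes the dual maximum insensitive to multipliers outside the box `Λ`: there the Slater
policy has negative Lagrangian, so such a multiplier does worse than `0`. Since minimizing over
fewer policies can only raise the minimum, `D*` is at most the parameterized max-min value
(`IsMaxMinSolution.dualValue_le`). That value is then compared with the Lagrangian at the limit
point by perturbation (`Game.lagrangian_sub_le`): changing the policy costs a multiple of the
occupation distance, and changing the multiplier inside the box costs at most `‖λ^max‖₁`. From the
algorithm comes the fact that projections keep the iterates, hence their limits, in the closed sets
`Θ` and `Λ`. The Kemeny term and the factor `K` are nonnegative slack in the resulting bound. -/

lemma jointPolicy_mem_stdSimplex {N : ℕ} {S : Type*} {A : Fin N → Type*} [∀ n, Fintype (A n)]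
    {p : ∀ n, S → A n → ℝ} (hp : ∀ n, p n ∈ localPolicies S (A n)) (s : S) :
    jointPolicy p s ∈ stdSimplex ℝ (∀ n, A n) := by
  classical
  refine ⟨fun a => Finset.prod_nonneg fun n _ => (hp n s).1 _, ?_⟩
  simp only [jointPolicy]
  rw [← Fintype.prod_sum fun n x => p n s x]
  exact Finset.prod_eq_one fun n _ => (hp n s).2

lemma mem_stdSimplex_of_mem_productPolicies {N : ℕ} {S : Type*} {A : Fin N → Type*}
    [∀ n, Fintype (A n)] {π : S → (∀ n, A n) → ℝ} (hπ : π ∈ productPolicies S A) (s : S) :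
    π s ∈ stdSimplex ℝ (∀ n, A n) := by
  obtain ⟨p, hp, rfl⟩ := hπ
  exact jointPolicy_mem_stdSimplex hp s

lemma sum_mul_mem_Icc {ι : Type*} [Fintype ι] {w x : ι → ℝ} (hw : w ∈ stdSimplex ℝ ι)
    (hx : ∀ i, x i ∈ Set.Icc (0 : ℝ) 1) : ∑ i, w i * x i ∈ Set.Icc (0 : ℝ) 1 := by
  refine ⟨Finset.sum_nonneg fun i _ => mul_nonneg (hw.1 i) (hx i).1, ?_⟩
  rw [← hw.2]
  exact Finset.sum_le_sum fun i _ => mul_le_of_le_one_right (hw.1 i) (hx i).2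

lemma average_mem_Icc {N : ℕ} [NeZero N] {x : Fin N → ℝ} (hx : ∀ n, x n ∈ Set.Icc (0 : ℝ) 1) :
    (1 / (N : ℝ)) * ∑ n, x n ∈ Set.Icc (0 : ℝ) 1 := by
  have hN : (0 : ℝ) < N := Nat.cast_pos.2 (NeZero.pos N)
  rw [Finset.mul_sum]
  refine sum_mul_mem_Icc ⟨fun _ => by positivity, ?_⟩ hx
  simp [hN.ne']

/-! ### Bounds on costs, finiteness of the primal and dual values, and consequences of Slater's
condition. -/

namespace Game

variable {N K : ℕ} {S : Type*} {A : Fin N → Type*} [Fintype S] [∀ n, Fintype (A n)]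

lemma isStationary_stationary (M : Game N K S A) {π : S → (∀ n, A n) → ℝ}
    (h : ∃ d, M.IsStationary π d) : M.IsStationary π (M.stationary π) := by
  rw [stationary, dif_pos h]
  exact h.choose_spec

/-- A stationary average of a `[0, 1]`-valued cost lies in `[0, 1]`. -/
lemma stationary_average_mem_Icc (M : Game N K S A) {π : S → (∀ n, A n) → ℝ}
    (hπ : π ∈ productPolicies S A) (h : ∃ d, M.IsStationary π d) {f : S → (∀ n, A n) → ℝ}
    (hf : ∀ s a, f s a ∈ Set.Icc (0 : ℝ) 1) :
    ∑ s, M.stationary π s * ∑ a, π s a * f s a ∈ Set.Icc (0 : ℝ) 1 :=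
  sum_mul_mem_Icc (M.isStationary_stationary h).1 fun s =>
    sum_mul_mem_Icc (mem_stdSimplex_of_mem_productPolicies hπ s) (hf s)

/-- Stationary averages of a `[0, 1]`-valued cost are `1`-Lipschitz in the occupation measure. -/
lemma stationary_average_sub_le (M : Game N K S A) (π π' : S → (∀ n, A n) → ℝ)
    {f : S → (∀ n, A n) → ℝ} (hf : ∀ s a, f s a ∈ Set.Icc (0 : ℝ) 1) :
    ∑ s, M.stationary π s * ∑ a, π s a * f s a - ∑ s, M.stationary π' s * ∑ a, π' s a * f s a ≤
      M.occupationDist π π' := by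
  simp only [occupationDist, occupation, Finset.mul_sum, ← Finset.sum_sub_distrib]
  refine Finset.sum_le_sum fun s _ => Finset.sum_le_sum fun a _ => ?_
  calc _ = (M.stationary π s * π s a - M.stationary π' s * π' s a) * f s a := by ring
    _ ≤ |M.stationary π s * π s a - M.stationary π' s * π' s a| * f s a :=
      mul_le_mul_of_nonneg_right (le_abs_self _) (hf s a).1
    _ ≤ _ := mul_le_of_le_one_right (abs_nonneg _) (hf s a).2

section

variable [NeZero N] (M : Game N K S A)

lemma objective_mem_Icc {π : S → (∀ n, A n) → ℝ} (hπ : π ∈ productPolicies S A)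
    (h : ∃ d, M.IsStationary π d) : M.objective π ∈ Set.Icc (0 : ℝ) 1 :=
  M.stationary_average_mem_Icc hπ h fun s a => average_mem_Icc fun n => M.c_mem n s a

lemma constraint_mem_Icc {π : S → (∀ n, A n) → ℝ} (hπ : π ∈ productPolicies S A)
    (h : ∃ d, M.IsStationary π d) (k : Fin K) : M.constraint k π ∈ Set.Icc (0 : ℝ) 1 :=
  M.stationary_average_mem_Icc hπ h fun s a => average_mem_Icc fun n => M.g_mem n k s a

lemma objective_sub_le (π π' : S → (∀ n, A n) → ℝ) :
    M.objective π - M.objective π' ≤ M.occupationDist π π' :=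
  M.stationary_average_sub_le π π' fun s a => average_mem_Icc fun n => M.c_mem n s a

lemma constraint_sub_le (π π' : S → (∀ n, A n) → ℝ) (k : Fin K) :
    M.constraint k π - M.constraint k π' ≤ M.occupationDist π π' :=
  M.stationary_average_sub_le π π' fun s a => average_mem_Icc fun n => M.g_mem n k s a

end

variable (M : Game N K S A)

lemma occupationDist_nonneg (π π' : S → (∀ n, A n) → ℝ) : 0 ≤ M.occupationDist π π' :=
  Finset.sum_nonneg fun _ _ => Finset.sum_nonneg fun _ _ => abs_nonneg _

lemma lagrangian_zero (π : S → (∀ n, A n) → ℝ) : M.lagrangian π 0 = M.objective π := by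
  simp [lagrangian]

/-- Weak duality: for fixed `l` and `π`, the Lagrangian lies between the inner infimum and the inner
supremum. -/
lemma dualValue_le_primalValue : M.dualValue ≤ M.primalValue :=
  iSup₂_le fun l hl => le_iInf₂ fun π hπ =>
    (iInf₂_le π hπ).trans (le_iSup₂ (f := fun l (_ : l ∈ orthant K) =>
      ((M.lagrangian π l : ℝ) : EReal)) l hl)

section

variable [NeZero N] {M} (hstat : ∀ π ∈ productPolicies S A, ∃ d, M.IsStationary π d)

include hstat

/-- Test the supremum at the zero multiplier, where the Lagrangian is the nonnegative objective. -/
lemma dualValue_nonneg : 0 ≤ M.dualValue := by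
  refine le_trans ?_ (le_iSup₂ (f := fun l (_ : l ∈ orthant K) =>
    ⨅ π ∈ productPolicies S A, ((M.lagrangian π l : ℝ) : EReal)) 0 fun _ => le_rfl)
  refine le_iInf₂ fun π hπ => ?_
  rw [M.lagrangian_zero]
  exact EReal.coe_nonneg.2 (M.objective_mem_Icc hπ (hstat π hπ)).1

/-- Under Slater's condition, the Lagrangian of the Slater policy is small for large multipliers. -/
lemma lagrangian_le_of_slater {π : S → (∀ n, A n) → ℝ} (hπ : π ∈ productPolicies S A)
    {δ : Fin K → ℝ} (hslater : ∀ k, M.constraint k π ≤ M.b k - δ k)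
    {l : EuclideanSpace ℝ (Fin K)} (hl : l ∈ orthant K) :
    M.lagrangian π l ≤ 1 - ∑ k, l k * δ k := by
  have h : ∑ k, l k * (M.constraint k π - M.b k) ≤ ∑ k, -(l k * δ k) :=
    Finset.sum_le_sum fun k _ => by
      rw [← mul_neg]
      exact mul_le_mul_of_nonneg_left (by linarith [hslater k]) (hl k)
  rw [Finset.sum_neg_distrib] at h
  have := (M.objective_mem_Icc hπ (hstat π hπ)).2
  unfold lagrangian
  linarith

lemma primalValue_le_one {π : S → (∀ n, A n) → ℝ} (hπ : π ∈ productPolicies S A)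
    {δ : Fin K → ℝ} (hδ : ∀ k, 0 < δ k) (hslater : ∀ k, M.constraint k π ≤ M.b k - δ k) :
    M.primalValue ≤ 1 := by
  refine (iInf₂_le π hπ).trans (iSup₂_le fun l hl => ?_)
  have h := lagrangian_le_of_slater hstat hπ hslater hl
  have : 0 ≤ ∑ k, l k * δ k := Finset.sum_nonneg fun k _ => mul_nonneg (hl k) (hδ k).le
  exact_mod_cast show M.lagrangian π l ≤ 1 by linarith

/-- Both values are trapped: `0 ≤ D* ≤ P* ≤ 1`. -/
lemma values_finite {π : S → (∀ n, A n) → ℝ} (hπ : π ∈ productPolicies S A)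
    {δ : Fin K → ℝ} (hδ : ∀ k, 0 < δ k) (hslater : ∀ k, M.constraint k π ≤ M.b k - δ k) :
    M.primalValue ≠ ⊤ ∧ M.primalValue ≠ ⊥ ∧ M.dualValue ≠ ⊤ ∧ M.dualValue ≠ ⊥ := by
  have h0 := dualValue_nonneg hstat
  have h1 := primalValue_le_one hstat hπ hδ hslater
  have hle := M.dualValue_le_primalValue
  have htop : (1 : EReal) ≠ ⊤ := EReal.coe_ne_top 1
  have hbot : (0 : EReal) ≠ ⊥ := EReal.coe_ne_bot 0
  exact ⟨ne_top_of_le_ne_top htop h1, ne_bot_of_le_ne_bot hbot (h0.trans hle),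
    ne_top_of_le_ne_top htop (hle.trans h1), ne_bot_of_le_ne_bot hbot h0⟩

/-- Finiteness is essential: `toReal` sends both infinities to `0`, so it is monotone only away from
them. -/
lemma dualityGap_nonneg {π : S → (∀ n, A n) → ℝ} (hπ : π ∈ productPolicies S A)
    {δ : Fin K → ℝ} (hδ : ∀ k, 0 < δ k) (hslater : ∀ k, M.constraint k π ≤ M.b k - δ k) :
    0 ≤ M.dualityGap := by
  obtain ⟨hP, -, -, hD⟩ := values_finite hstat hπ hδ hslater
  exact sub_nonneg.2 (EReal.toReal_le_toReal M.dualValue_le_primalValue hD hP)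

/-- A multiplier at which the Slater policy has a nonnegative Lagrangian lies in the box `Λ`. -/
lemma mem_multiplierBox_of_lagrangian_nonneg {π : S → (∀ n, A n) → ℝ}
    (hπ : π ∈ productPolicies S A) {δ : Fin K → ℝ} (hδ : ∀ k, 0 < δ k)
    (hslater : ∀ k, M.constraint k π ≤ M.b k - δ k)
    {l : EuclideanSpace ℝ (Fin K)} (hl : l ∈ orthant K) (h : 0 ≤ M.lagrangian π l) :
    l ∈ M.multiplierBox δ := by
  intro k
  have h1 := lagrangian_le_of_slater hstat hπ hslater hl
  have h2 : l k * δ k ≤ ∑ j, l j * δ j :=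
    Finset.single_le_sum (f := fun j => l j * δ j)
      (fun j _ => mul_nonneg (hl j) (hδ j).le) (Finset.mem_univ k)
  have h3 := dualityGap_nonneg hstat hπ hδ hslater
  refine ⟨hl k, ?_⟩
  change l k ≤ (1 + M.dualityGap) / δ k
  rw [le_div_iff₀ (hδ k)]
  -- Nonnegativity at the Slater policy gives `l k * δ k ≤ 1`, and `1 ≤ 1 + gap`.
  linarith

end

end Game

/-! ### The parameterized max-min value dominates the dual value. -/

namespace ParamClass

variable {N K m : ℕ} {S : Type*} {A : Fin N → Type*} [∀ n, Fintype (A n)]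

lemma policy_mem_productPolicies (F : ParamClass m S A)
    {θ : Fin N → EuclideanSpace ℝ (Fin m)} (hθ : θ ∈ F.space) :
    F.policy θ ∈ productPolicies S A :=
  ⟨_, fun n => F.pol_mem n _ (hθ n), rfl⟩

/-- Any local policy bounds `ε` below by an `L¹` distance at some state; a deterministic one serves
as the test policy. -/
lemma IsIndividualParam.nonneg [Nonempty S] {F : ParamClass m S A} {n : Fin N} [Nonempty (A n)]
    {ε : ℝ} (h : F.IsIndividualParam n ε) : 0 ≤ ε := by
  classical
  obtain ⟨x⟩ := ‹Nonempty (A n)›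
  obtain ⟨θ, -, hθ⟩ := h (fun _ => Pi.single x 1) fun _ => single_mem_stdSimplex ℝ x
  exact (Finset.sum_nonneg fun _ _ => abs_nonneg _).trans (hθ (Classical.arbitrary S))

/-- The dual value is at most the value of the parameterized max-min problem over the box. -/
lemma IsMaxMinSolution.dualValue_le [Fintype S] [NeZero N] {F : ParamClass m S A}
    {M : Game N K S A} (hstat : ∀ π ∈ productPolicies S A, ∃ d, M.IsStationary π d)
    {π : S → (∀ n, A n) → ℝ} (hπ : π ∈ productPolicies S A) {δ : Fin K → ℝ} (hδ : ∀ k, 0 < δ k)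
    (hslater : ∀ k, M.constraint k π ≤ M.b k - δ k)
    {θ : Fin N → EuclideanSpace ℝ (Fin m)} {l : EuclideanSpace ℝ (Fin K)}
    (hs : F.IsMaxMinSolution M (M.multiplierBox δ) θ l) :
    M.dualValue ≤ ((M.lagrangian (F.policy θ) l : ℝ) : EReal) := by
  have hgap := Game.dualityGap_nonneg hstat hπ hδ hslater
  -- Inside the box: shrinking the policy class to `Θ` raises the infimum, and the max-min solution
  -- is optimal among multipliers in the box.
  have key : ∀ l' ∈ M.multiplierBox δ,
      (⨅ π ∈ productPolicies S A, ((M.lagrangian π l' : ℝ) : EReal)) ≤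
        ((M.lagrangian (F.policy θ) l : ℝ) : EReal) := fun l' hl' =>
    (le_iInf₂ fun θ' hθ' => iInf₂_le _ (F.policy_mem_productPolicies hθ')).trans
      (hs.2.2.2 l' hl')
  refine iSup₂_le fun l' hl' => ?_
  rcases le_or_gt 0 (M.lagrangian π l') with h | h
  · exact key l' (Game.mem_multiplierBox_of_lagrangian_nonneg hstat hπ hδ hslater hl' h)
  -- Here the Slater policy makes the infimum at `l'` negative, while the infimum at `0`, which lies
  -- in the box, is nonnegative because objectives are.
  · refine (iInf₂_le π hπ).trans ((EReal.coe_le_coe_iff.2 h.le).trans (le_trans ?_ (key 0 ?_)))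
    · refine le_iInf₂ fun π' hπ' => ?_
      rw [M.lagrangian_zero]
      exact EReal.coe_le_coe_iff.2 (M.objective_mem_Icc hπ' (hstat π' hπ')).1
    · exact fun k => ⟨le_rfl, div_nonneg (by linarith) (hδ k).le⟩

end ParamClass

/-- The Lagrangians of two policies at multipliers from the box differ by at most the size of the
box plus a multiple of the distance of the occupation measures. -/
lemma Game.lagrangian_sub_le {N K : ℕ} [NeZero N] {S : Type*} {A : Fin N → Type*} [Fintype S]
    [∀ n, Fintype (A n)] (M : Game N K S A) {δ : Fin K → ℝ} {π π' : S → (∀ n, A n) → ℝ}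
    (hG : ∀ k, |M.constraint k π' - M.b k| ≤ 1) {l l' : EuclideanSpace ℝ (Fin K)}
    (hl : l ∈ M.multiplierBox δ) (hl' : l' ∈ M.multiplierBox δ) :
    M.lagrangian π l - M.lagrangian π' l' ≤
      l1norm (M.lamMax δ) + (1 + l1norm (M.lamMax δ)) * M.occupationDist π π' := by
  have hk : ∀ k, l k * (M.constraint k π - M.b k) - l' k * (M.constraint k π' - M.b k) ≤
      |M.lamMax δ k| + |M.lamMax δ k| * M.occupationDist π π' := by
    intro k
    -- Split the difference as `l k * (G_k π - G_k π') + (l k - l' k) * (G_k π' - b k)`; only `π'`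
    -- needs the bound `hG`.
    have h1 : l k * (M.constraint k π - M.constraint k π') ≤
        |M.lamMax δ k| * M.occupationDist π π' :=
      (mul_le_mul_of_nonneg_left (M.constraint_sub_le π π' k) (hl k).1).trans
        (mul_le_mul_of_nonneg_right ((hl k).2.trans (le_abs_self _))
          (M.occupationDist_nonneg π π'))
    have h2 : |l k - l' k| ≤ |M.lamMax δ k| := by
      have := le_abs_self (M.lamMax δ k)
      rw [abs_le]
      constructor <;> linarith [(hl k).1, (hl k).2, (hl' k).1, (hl' k).2]
    have h3 : (l k - l' k) * (M.constraint k π' - M.b k) ≤ |M.lamMax δ k| := by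
      refine (le_abs_self _).trans ?_
      rw [abs_mul]
      exact (mul_le_of_le_one_right (abs_nonneg _) (hG k)).trans h2
    linarith
  have hsum := Finset.sum_le_sum fun k (_ : k ∈ Finset.univ) => hk k
  rw [Finset.sum_sub_distrib, Finset.sum_add_distrib, ← Finset.sum_mul] at hsum
  have := M.objective_sub_le π π'
  unfold lagrangian l1norm
  linarith

/-! ### Invariance of `Θ` and `Λ` under the projected updates. -/

namespace Run

variable {N K m p : ℕ} {S : Type*} {A : Fin N → Type*} [Fintype S] [∀ n, Fintype (A n)]
  {Ω : Type*} [MeasurableSpace Ω] {M : Game N K S A} {F : ParamClass m S A}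
  {Lam : Set (EuclideanSpace ℝ (Fin K))} {φ : S → (∀ n, A n) → EuclideanSpace ℝ (Fin p)}
  {α β γ : ℕ → ℝ} {μ : Measure Ω} (R : Run M F Lam φ α β γ μ)

include R

lemma ae_θ_mem : ∀ᵐ ω ∂μ, ∀ t, R.θ t ω ∈ F.space := by
  filter_upwards [R.θ_zero, R.θ_succ] with ω h0 hs t
  cases t with
  | zero => exact h0
  | succ t => exact fun n => (hs t n).1

lemma ae_lam_mem : ∀ᵐ ω ∂μ, ∀ t n, R.lam t ω n ∈ Lam := by
  filter_upwards [R.lam_zero, R.lam_succ] with ω h0 hs t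
  cases t with
  | zero => exact h0
  | succ t => exact fun n => (hs t n).1

end Run

lemma Game.isClosed_multiplierBox {N K : ℕ} {S : Type*} {A : Fin N → Type*} [Fintype S]
    [∀ n, Fintype (A n)] (M : Game N K S A) (δ : Fin K → ℝ) :
    IsClosed (M.multiplierBox δ) := by
  simp only [multiplierBox, Set.ofPred_forall]
  exact isClosed_iInter fun k => isClosed_Icc.preimage (by fun_prop)

end CMARL

/-! ### Passage to the limit and assembly of the bound. -/

theorem mainTheorem4 {N K m p : ℕ} [NeZero N] {S : Type*} [Fintype S] [DecidableEq S] [Nonempty S]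
    {A : Fin N → Type*} [∀ n, Fintype (A n)] [∀ n, Nonempty (A n)]
    (M : CMARL.Game N K S A) (F : CMARL.ParamClass m S A)
    -- the constraint levels are on the scale of the normalized costs
    (hb : ∀ k, M.b k ≤ 1)
    -- ergodicity
    (herg : ∀ θ ∈ F.space, CMARL.IsIrreducibleChain (M.transition (F.policy θ)) ∧
      CMARL.IsAperiodicChain (M.transition (F.policy θ)))
    (hstat : ∀ π ∈ CMARL.productPolicies S A, ∃! d, M.IsStationary π d)
    -- Slater's condition
    (πs : S → (∀ n, A n) → ℝ) (hπs : πs ∈ CMARL.productPolicies S A)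
    (δ : Fin K → ℝ) (hδ : ∀ k, 0 < δ k) (hslater : ∀ k, M.constraint k πs ≤ M.b k - δ k)
    -- individual parameterization errors
    (ε : Fin N → ℝ) (hε : ∀ n, F.IsIndividualParam n (ε n))
    -- the parameterized max-min solution, with its multiplier
    (θs : Fin N → EuclideanSpace ℝ (Fin m)) (ls : EuclideanSpace ℝ (Fin K))
    (hs : F.IsMaxMinSolution M (M.multiplierBox δ) θs ls)
    -- a run of the algorithm
    {Ω : Type*} [MeasurableSpace Ω] (μ : MeasureTheory.Measure Ω)
    [MeasureTheory.IsProbabilityMeasure μ]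
    (φ : S → (∀ n, A n) → EuclideanSpace ℝ (Fin p)) (α β γ : ℕ → ℝ)
    (R : CMARL.Run M F (M.multiplierBox δ) φ α β γ μ) :
    (M.primalValue ≠ ⊤ ∧ M.primalValue ≠ ⊥ ∧ M.dualValue ≠ ⊤ ∧ M.dualValue ≠ ⊥) ∧
    ∀ᵐ ω ∂μ, ∀ (θbar : Fin N → EuclideanSpace ℝ (Fin m)) (lbar : EuclideanSpace ℝ (Fin K)),
      (∀ n, Filter.Tendsto (fun t => R.θ t ω n) Filter.atTop (nhds (θbar n))) →
      (∀ n, Filter.Tendsto (fun t => R.lam t ω n) Filter.atTop (nhds lbar)) →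
      M.primalValue.toReal - M.lagrangian (F.policy θbar) lbar ≤
        CMARL.l1norm (M.lamMax δ) +
          (1 + (K : ℝ) * CMARL.l1norm (M.lamMax δ)) *
            (M.maxKemeny * ∑ n, ε n + M.occupationDist (F.policy θs) (F.policy θbar)) +
          M.dualityGap := by
  have hst : ∀ π ∈ CMARL.productPolicies S A, ∃ d, M.IsStationary π d :=
    fun π hπ => (hstat π hπ).exists
  have hfin := CMARL.Game.values_finite hst hπs hδ hslater
  refine ⟨hfin, ?_⟩
  filter_upwards [R.ae_θ_mem, R.ae_lam_mem] with ω hθ hlam θbar lbar hθbar hlbar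
  have hθbar_mem : θbar ∈ F.space := fun n =>
    (F.isCompact n).isClosed.mem_of_tendsto (hθbar n) (Filter.Eventually.of_forall fun t => hθ t n)
  have hlbar_mem : lbar ∈ M.multiplierBox δ :=
    (M.isClosed_multiplierBox δ).mem_of_tendsto (hlbar 0)
      (Filter.Eventually.of_forall fun t => hlam t 0)
  have hπbar := F.policy_mem_productPolicies hθbar_mem
  -- The constraint lies in `[0, 1]`, and so does `b k`: Slater's condition forces `b k ≥ δ k > 0`,
  -- and `hb` gives the upper bound.
  have hG : ∀ k, |M.constraint k (F.policy θbar) - M.b k| ≤ 1 := fun k => by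
    have h1 := M.constraint_mem_Icc hπbar (hst _ hπbar) k
    have h2 := M.constraint_mem_Icc hπs (hst _ hπs) k
    rw [abs_le]
    constructor <;> linarith [h1.1, h1.2, h2.1, hslater k, hδ k, hb k]
  have hdual : M.dualValue.toReal ≤ M.lagrangian (F.policy θs) ls :=
    EReal.toReal_le_toReal (hs.dualValue_le hst hπs hδ hslater) hfin.2.2.2 (EReal.coe_ne_top _)
  have hdiff := M.lagrangian_sub_le (π := F.policy θs) hG hs.2.1 hlbar_mem
  have hl1 : 0 ≤ CMARL.l1norm (M.lamMax δ) := Finset.sum_nonneg fun _ _ => abs_nonneg _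
  -- For `K = 0` the norm is an empty sum, so both sides vanish.
  have hK : CMARL.l1norm (M.lamMax δ) ≤ K * CMARL.l1norm (M.lamMax δ) := by
    rcases Nat.eq_zero_or_pos K with rfl | hK
    · simp [CMARL.l1norm]
    · exact le_mul_of_one_le_left hl1 (Nat.one_le_cast.2 hK)
  -- Nonnegativity of `toReal` holds for every value of the supremum, `⊤` included, so the term can
  -- only enlarge the bound.
  have hκ : 0 ≤ M.maxKemeny * ∑ n, ε n :=
    mul_nonneg ENNReal.toReal_nonneg (Finset.sum_nonneg fun n _ => (hε n).nonneg)
  have hocc := M.occupationDist_nonneg (F.policy θs) (F.policy θbar)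
  have hmul : (1 + CMARL.l1norm (M.lamMax δ)) *
        M.occupationDist (F.policy θs) (F.policy θbar) ≤
      (1 + (K : ℝ) * CMARL.l1norm (M.lamMax δ)) *
        (M.maxKemeny * ∑ n, ε n + M.occupationDist (F.policy θs) (F.policy θbar)) :=
    mul_le_mul (by linarith) (by linarith) hocc (by linarith)
  -- With the gap written as `P* - D*`, the claim reduces to bounding `D*` minus the Lagrangian at
  -- the limit, by `hdual`, `hdiff` and `hmul`.
  unfold CMARL.Game.dualityGap
  linarith
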